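/- Let $G=(X,Y,E)$ be a simple bipartite graph with $n$ vertices ($X$ and $Y$ disjoint, every edge joining $X$ to $Y$, $n=|X|+|Y|$) that is $d$-regular with $1\le d\le n/4$, and let $k\ge 1$ and $0\le t\le k$ be integers. Let $BGP_{k,t}(G)$ be the bipartite graph with vertex classes $X^k$ and $Y^k$ in which $(x_1,\dots,x_k)\in X^k$ and $(y_1,\dots,y_k)\in Y^k$ are adjacent if and only if $\{x_i,y_i\}\in E$ for at least $t$ indices $i$. Put $$d_2=\sum_{t'=t}^{k}\binom{k}{t'}\,d^{t'}\left(\frac n2-d\right)^{k-t'},\qquad \alpha=\sum_{\ell=0}^{k-t}\frac{\binom{k-t}{\ell}}{\binom{t+\ell}{\ell}} .$$ Let $\lambda$ be the third largest of the absolute values of the eigenvalues of the adjacency matrix of $G$, counted with multiplicity, and let $\Lambda$ be the third largest of the absolute values of the eigenvalues of the adjacency matrix of $BGP_{k,t}(G)$, counted with multiplicity. Then $$\frac{\lambda}{d}\cdot\frac1\alpha\cdot\frac tk\cdot d_2\;\le\;\Lambda\;\le\;\frac{\lambda}{d}\cdot d_2 .$$ -/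

import Mathlib

/-- The bipartite graph product `BGP_{k,t}(G)` of a graph `G` with vertex classes `X` and `Y`.
Its vertex set is the disjoint union of `X^k` and `Y^k`; the tuples `x ∈ X^k` and `y ∈ Y^k` are
adjacent iff `x i` and `y i` are adjacent in `G` for at least `t` of the indices `i`, and there
are no other edges. -/
def bipGraphProduct {V : Type*} (G : SimpleGraph V) [DecidableRel G.Adj] (X Y : Finset V)
    (k t : ℕ) : SimpleGraph ((Fin k → X) ⊕ (Fin k → Y)) where
  Adj a b :=
    match a, b with
    | Sum.inl x, Sum.inr y =>
        t ≤ (Finset.univ.filter fun i : Fin k => G.Adj (x i : V) (y i : V)).card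
    | Sum.inr y, Sum.inl x =>
        t ≤ (Finset.univ.filter fun i : Fin k => G.Adj (x i : V) (y i : V)).card
    | Sum.inl _, Sum.inl _ => False
    | Sum.inr _, Sum.inr _ => False
  symm := ⟨by rintro (x | y) (x' | y') h <;> exact h⟩
  loopless := ⟨by rintro (x | y) h <;> exact h⟩

instance bipGraphProduct.decidableRelAdj {V : Type*} (G : SimpleGraph V) [DecidableRel G.Adj]
    (X Y : Finset V) (k t : ℕ) : DecidableRel (bipGraphProduct G X Y k t).Adj := fun a b =>
  match a, b with
  | Sum.inl x, Sum.inr y => inferInstanceAs (Decidable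
      (t ≤ (Finset.univ.filter fun i : Fin k => G.Adj (x i : V) (y i : V)).card))
  | Sum.inr y, Sum.inl x => inferInstanceAs (Decidable
      (t ≤ (Finset.univ.filter fun i : Fin k => G.Adj (x i : V) (y i : V)).card))
  | Sum.inl _, Sum.inl _ => inferInstanceAs (Decidable False)
  | Sum.inr _, Sum.inr _ => inferInstanceAs (Decidable False)

/-- The adjacency matrix over `ℝ` is Hermitian. -/
theorem adjMatrix_real_isHermitian {W : Type*} (H : SimpleGraph W)
    [DecidableRel H.Adj] : (H.adjMatrix ℝ).IsHermitian := by
  rw [Matrix.IsHermitian, Matrix.conjTranspose_eq_transpose_of_trivial]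
  exact H.isSymm_adjMatrix

/-- The absolute values of the adjacency eigenvalues of `H`, listed with multiplicity in
decreasing order. -/
noncomputable def absEigenvalueList {W : Type*} [Fintype W] [DecidableEq W] (H : SimpleGraph W)
    [DecidableRel H.Adj] : List ℝ :=
  (Finset.univ.val.map fun w : W => |(adjMatrix_real_isHermitian H).eigenvalues w|).sort (· ≥ ·)

/-- The third largest absolute value of an adjacency eigenvalue of `H`, counted with multiplicity
(`0` if `H` has fewer than three vertices). -/
noncomputable def thirdAbsEigenvalue {W : Type*} [Fintype W] [DecidableEq W] (H : SimpleGraph W)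
    [DecidableRel H.Adj] : ℝ :=
  (absEigenvalueList H).getD 2 0

/-- `α(k,t) = ∑_{ℓ=0}^{k-t} C(k-t,ℓ) / C(t+ℓ,ℓ)`, for `t ≤ k`. -/
noncomputable def alphaCoeff (k t : ℕ) : ℝ :=
  ∑ l ∈ Finset.range (k - t + 1), ((k - t).choose l : ℝ) / ((t + l).choose l : ℝ)

/-- `d₂ = ∑_{t'=t}^{k} C(k,t') d^{t'} (n/2 - d)^{k-t'}`, the degree of `BGP_{k,t}(G)` for an
`n`-vertex `d`-regular bipartite graph `G`. -/
noncomputable def bipProductDegree (n d k t : ℕ) : ℝ :=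
  ∑ s ∈ Finset.Icc t k, (k.choose s : ℝ) * (d : ℝ) ^ s * ((n : ℝ) / 2 - (d : ℝ)) ^ (k - s)

/-! Let `M` be the biadjacency matrix of `G`. Squaring the adjacency matrix gives the blocks `M *
Mᵀ` and `Mᵀ * M`, so each eigenvalue of `Mᵀ * M` is the square of two adjacency eigenvalues, and the
third largest absolute value is the square root of the second largest eigenvalue of `Mᵀ * M`.
Regularity makes the all-ones vector an eigenvector with the top value `d²`; the remaining
eigenvectors are taken orthogonal to it.

The biadjacency matrix of the product is the sum, over sets `S` of at least `t` coordinates, of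
tensor products of `M` on `S` and `J - M` off `S`. On vectors orthogonal to the all-ones vector `J -
M` acts as `-M`, so tensor products of the eigenvectors of `Mᵀ * M` diagonalise the new Gram matrix
(`thresholdTensor_gram_mulVec_prod`). The all-ones tensor has singular value `d₂`.

Upper bound: any other tensor has a coordinate where a factor `d` or `e = n/2 - d ≥ d` becomes `±λ`,
which costs at least the ratio `λ/d` in every summand (`abs_thresholdCoeff_mul_prod_le`). Lower
bound: with exactly one such coordinate the sum telescopes to a single term
(`thresholdCoeff_single`), which is compared with `d₂` by bounding each summand of `d₂` against its
first one (`sum_choose_mul_pow_le_alphaCoeff`). -/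

/-! ### Characteristic roots and the third entry of a sorted list -/

open Finset Matrix Polynomial in
/-- The characteristic polynomial of a real square matrix with a full orthogonal family of
eigenvectors has the corresponding eigenvalues as its roots, with multiplicity. -/
theorem roots_charpoly_of_orthogonal_eigenvectors {ι Y : Type*} [Fintype ι] [DecidableEq ι]
    [Fintype Y] [DecidableEq Y] (B : Matrix Y Y ℝ) (v : ι → Y → ℝ) (μ : ι → ℝ)
    (hcard : Fintype.card ι = Fintype.card Y) (hne : ∀ i, v i ≠ 0)
    (ho : ∀ i j, i ≠ j → v i ⬝ᵥ v j = 0) (hB : ∀ i, B *ᵥ v i = μ i • v i) :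
    B.charpoly.roots = (univ : Finset ι).val.map μ := by
  have hli : LinearIndependent ℝ v := by
    rw [Fintype.linearIndependent_iff]
    intro g hg i
    have h := congrArg (fun u => v i ⬝ᵥ u) hg
    simp only [dotProduct_sum, dotProduct_smul, dotProduct_zero, smul_eq_mul] at h
    rw [Finset.sum_eq_single i (fun j _ hj => by rw [ho i j hj.symm, mul_zero]) (by simp)] at h
    exact (mul_eq_zero.1 h).resolve_right fun h0 => hne i (dotProduct_self_eq_zero.1 h0)
  have hfr : Fintype.card ι = Module.finrank ℝ (Y → ℝ) := by
    rw [hcard, Module.finrank_fintype_fun_eq_card]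
  by_cases hι : Nonempty ι
  · set b := basisOfLinearIndependentOfCardEqFinrank hli hfr with hb
    have hbv : ∀ i, b i = v i := fun i => by
      rw [hb, coe_basisOfLinearIndependentOfCardEqFinrank]
    have hmat : LinearMap.toMatrix b b (Matrix.toLin' B) = diagonal μ := by
      ext i j
      rw [LinearMap.toMatrix_apply, Matrix.toLin'_apply, hbv, hB, ← hbv, map_smul,
        Module.Basis.repr_self]
      by_cases hij : i = j
      · subst hij; simp
      · simp [hij]
    rw [← Matrix.charpoly_toLin', ← LinearMap.charpoly_toMatrix _ b, hmat, charpoly_diagonal]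
    have hprod : ∏ i, (X - C (μ i)) = ((univ.val.map μ).map fun a => X - C a).prod := by
      rw [Multiset.map_map]; rfl
    rw [hprod, roots_multiset_prod_X_sub_C]
  · rw [not_nonempty_iff] at hι
    have hY : IsEmpty Y := by
      rw [← Fintype.card_eq_zero_iff, ← hcard, Fintype.card_eq_zero_iff]; exact hι
    simp [Matrix.charpoly]

theorem le_getD_two_of_countP {l : List ℝ} (hs : l.Pairwise (· ≥ ·)) {b : ℝ}
    (h : 3 ≤ l.countP (b ≤ ·)) : b ≤ l.getD 2 0 := by
  match l, hs, h with
  | [], _, h => simp at h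
  | [x], _, h => have := List.countP_le_length.trans' h; simp at this
  | [x, y], _, h => have := List.countP_le_length.trans' h; simp at this
  | x :: y :: z :: r, hs, h =>
    by_contra hb
    simp only [List.getD_cons_succ, List.getD_cons_zero, not_le] at hb
    simp only [List.pairwise_cons] at hs
    have hr : (z :: r).countP (b ≤ ·) = 0 := by
      rw [List.countP_eq_zero]
      intro a ha
      rcases List.mem_cons.1 ha with rfl | ha
      · simpa using hb
      · simpa using (hs.2.2.1 a ha).trans_lt hb
    rw [List.countP_cons, List.countP_cons, hr] at h
    split_ifs at h <;> omega

/-- Nonnegativity of `b` covers the default value `0` of lists with fewer than three entries. -/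
theorem getD_two_le_of_countP {l : List ℝ} (hs : l.Pairwise (· ≥ ·)) {b : ℝ} (hb : 0 ≤ b)
    (h : l.countP (b < ·) ≤ 2) : l.getD 2 0 ≤ b := by
  match l, hs, h with
  | [], _, h => simpa
  | [x], _, h => simpa
  | [x, y], _, h => simpa
  | x :: y :: z :: r, hs, h =>
    by_contra hz
    simp only [List.getD_cons_succ, List.getD_cons_zero, not_le] at hz
    simp only [List.pairwise_cons] at hs
    have hy : b < y := hz.trans_le (hs.2.1 z (by simp))
    have hx : b < x := hz.trans_le (hs.1 z (by simp))
    rw [List.countP_cons, List.countP_cons, List.countP_cons] at h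
    simp [hx, hy, hz] at h

/-! ### From the adjacency spectrum to the Gram matrix -/

section BlockMatrix

open Finset Matrix Polynomial

theorem roots_charpoly_fromBlocks_sq {X Y : Type*} [Fintype X] [DecidableEq X] [Fintype Y]
    [DecidableEq Y] (hXY : Fintype.card X = Fintype.card Y) (M : Matrix X Y ℝ) :
    (fromBlocks 0 M Mᵀ 0 * fromBlocks 0 M Mᵀ 0).charpoly.roots
      = (Mᵀ * M).charpoly.roots + (Mᵀ * M).charpoly.roots := by
  have h : (M * Mᵀ).charpoly = (Mᵀ * M).charpoly := by
    rw [charpoly_mul_comm_of_le _ _ hXY.ge]; simp [hXY]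
  rw [fromBlocks_multiply]
  simp only [Matrix.zero_mul, Matrix.mul_zero, zero_add, add_zero]
  rw [charpoly_fromBlocks_zero₁₂, h, roots_mul]
  exact mul_ne_zero (charpoly_monic _).ne_zero (charpoly_monic _).ne_zero

variable {W X Y ι : Type*} [Fintype W] [DecidableEq W] [Fintype X] [DecidableEq X] [Fintype Y]
  [DecidableEq Y] [Fintype ι] [DecidableEq ι]

/-- The squared adjacency eigenvalues of a bipartite graph with biadjacency matrix `M` are the
eigenvalues of `Mᵀ * M`, each taken twice. -/
theorem map_sq_eigenvalues_of_biadjacency (H : SimpleGraph W) [DecidableRel H.Adj] (e : W ≃ X ⊕ Y)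
    (M : Matrix X Y ℝ) (hM : Matrix.reindex e e (H.adjMatrix ℝ) = fromBlocks 0 M Mᵀ 0)
    (hXY : Fintype.card X = Fintype.card Y) :
    ((univ : Finset W).val.map fun w => (adjMatrix_real_isHermitian H).eigenvalues w ^ 2)
      = (Mᵀ * M).charpoly.roots + (Mᵀ * M).charpoly.roots := by
  set hA := adjMatrix_real_isHermitian H
  rw [← roots_charpoly_fromBlocks_sq hXY, ← hM, reindex_apply, submatrix_mul_equiv,
    ← reindex_apply, charpoly_reindex]
  refine (roots_charpoly_of_orthogonal_eigenvectors _
    (fun w => (WithLp.ofLp (hA.eigenvectorBasis w) : W → ℝ)) _ rfl ?_ ?_ ?_).symm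
  · intro i h0
    apply hA.eigenvectorBasis.orthonormal.ne_zero i
    ext x
    exact congrFun h0 x
  · intro i j hij
    have : inner ℝ (hA.eigenvectorBasis i) (hA.eigenvectorBasis j) = 0 :=
      hA.eigenvectorBasis.orthonormal.2 hij
    rw [EuclideanSpace.inner_eq_star_dotProduct] at this
    simpa [dotProduct_comm] using this
  · intro i
    rw [← mulVec_mulVec, hA.mulVec_eigenvectorBasis, mulVec_smul, hA.mulVec_eigenvectorBasis,
      smul_smul, sq]

variable (H : SimpleGraph W) [DecidableRel H.Adj] (e : W ≃ X ⊕ Y)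
    (M : Matrix X Y ℝ) (hM : Matrix.reindex e e (H.adjMatrix ℝ) = fromBlocks 0 M Mᵀ 0)
    (hXY : Fintype.card X = Fintype.card Y) (v : ι → Y → ℝ) (μ : ι → ℝ)
    (hcard : Fintype.card ι = Fintype.card Y) (hne : ∀ i, v i ≠ 0)
    (ho : ∀ i j, i ≠ j → v i ⬝ᵥ v j = 0) (hB : ∀ i, (Mᵀ * M) *ᵥ v i = μ i • v i)

include hM hXY hcard hne ho hB

/-- The factor two turns third place into second: two Gram eigenvalues above a bound give four
adjacency eigenvalues, while a single one gives only two. -/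
theorem countP_absEigenvalueList (p q : ℝ → Prop) [DecidablePred p] [DecidablePred q]
    (hpq : ∀ x, p |x| ↔ q (x ^ 2)) :
    (absEigenvalueList H).countP (fun x => decide (p x)) = 2 * #{j | q (μ j)} := by
  have h1 := map_sq_eigenvalues_of_biadjacency H e M hM hXY
  rw [roots_charpoly_of_orthogonal_eigenvectors _ v μ hcard hne ho hB] at h1
  have h2 := congrArg (Multiset.countP q) h1
  rw [Multiset.countP_add, Multiset.countP_map, Multiset.countP_map] at h2
  have h3 : (absEigenvalueList H).countP (fun x => decide (p x))
      = Multiset.countP p (absEigenvalueList H : Multiset ℝ) := by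
    rw [Multiset.coe_countP]
  rw [h3, absEigenvalueList, Multiset.sort_eq, Multiset.countP_map]
  simp only [hpq, ← Finset.filter_val] at h2 ⊢
  rw [h2, two_mul]; rfl

theorem le_thirdAbsEigenvalue_of_biadjacency {b : ℝ} (hb : 0 ≤ b) {j₀ j₁ : ι} (hj : j₀ ≠ j₁)
    (h₀ : b ^ 2 ≤ μ j₀) (h₁ : b ^ 2 ≤ μ j₁) : b ≤ thirdAbsEigenvalue H := by
  refine le_getD_two_of_countP (Multiset.pairwise_sort _ _) ?_
  have := countP_absEigenvalueList H e M hM hXY v μ hcard hne ho hB (b ≤ ·) (b ^ 2 ≤ ·)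
    (fun x => by rw [← sq_abs x, sq_le_sq₀ hb (abs_nonneg _)])
  rw [absEigenvalueList] at this
  rw [this]
  have : #({j₀, j₁} : Finset ι) ≤ #{j | b ^ 2 ≤ μ j} := card_le_card fun j hj' => by
    rcases Finset.mem_insert.1 hj' with rfl | hj'
    · simpa
    · rw [Finset.mem_singleton.1 hj']; simpa
  rw [card_pair hj] at this
  omega

theorem thirdAbsEigenvalue_le_of_biadjacency {b : ℝ} (hb : 0 ≤ b) (j₀ : ι)
    (h : ∀ j, j ≠ j₀ → μ j ≤ b ^ 2) : thirdAbsEigenvalue H ≤ b := by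
  refine getD_two_le_of_countP (Multiset.pairwise_sort _ _) hb ?_
  have := countP_absEigenvalueList H e M hM hXY v μ hcard hne ho hB (b < ·) (b ^ 2 < ·)
    (fun x => by rw [← sq_abs x, sq_lt_sq₀ hb (abs_nonneg _)])
  rw [absEigenvalueList] at this
  rw [this]
  have : #{j | b ^ 2 < μ j} ≤ #({j₀} : Finset ι) := card_le_card fun j hj' => by
    by_contra hj
    exact absurd (Finset.mem_filter.1 hj').2 (h j (by simpa using hj)).not_gt
  rw [card_singleton] at this
  omega

end BlockMatrix

/-! ### Orthogonal eigenvectors and tensor products -/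

section EigenvectorFamilies

open Finset Matrix

variable {X Y ι : Type*} [Fintype X] [Fintype Y] [DecidableEq Y]

/-- By symmetry `B` preserves the orthogonal complement of the all-ones vector; the spectral theorem
is applied to the restriction. -/
theorem exists_orthogonal_eigenvectors_of_mulVec_one [Nonempty Y] {B : Matrix Y Y ℝ}
    (hB : B.IsHermitian) {c : ℝ} (h1 : B *ᵥ 1 = c • 1) :
    ∃ (r : ℕ) (v : Fin r → Y → ℝ) (μ : Fin r → ℝ), r + 1 = Fintype.card Y ∧ (∀ i, v i ≠ 0) ∧
      (∀ i j, i ≠ j → v i ⬝ᵥ v j = 0) ∧ (∀ i, v i ⬝ᵥ 1 = 0) ∧ ∀ i, B *ᵥ v i = μ i • v i := by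
  set T : EuclideanSpace ℝ Y →ₗ[ℝ] EuclideanSpace ℝ Y := toEuclideanLin B with hT
  have hsymm : T.IsSymmetric := Matrix.isSymmetric_toEuclideanLin_iff.2 hB
  set u : EuclideanSpace ℝ Y := WithLp.toLp 2 1 with hu
  have hu0 : u ≠ 0 := fun h => by
    have := congrFun (congrArg WithLp.ofLp h) (Classical.arbitrary Y)
    simp [hu] at this
  have hTu : T u = c • u := by
    rw [hT, hu, toLpLin_toLp, toLin'_apply, h1]; rfl
  set K : Submodule ℝ (EuclideanSpace ℝ Y) := (ℝ ∙ u)ᗮ with hK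
  have hinv : ∀ x ∈ K, T x ∈ K := fun x hx => by
    rw [hK, Submodule.mem_orthogonal_singleton_iff_inner_right] at hx ⊢
    rw [← hsymm, hTu, inner_smul_left, hx, mul_zero]
  have hr : Module.finrank ℝ K + 1 = Fintype.card Y := by
    rw [← finrank_euclideanSpace (𝕜 := ℝ) (ι := Y), ← (ℝ ∙ u).finrank_add_finrank_orthogonal,
      finrank_span_singleton hu0, add_comm]
  have hTK := hsymm.restrict_invariant hinv
  set b := hTK.eigenvectorBasis rfl with hb
  refine ⟨_, fun i => WithLp.ofLp (b i : EuclideanSpace ℝ Y), hTK.eigenvalues rfl, hr,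
    fun i h0 => b.orthonormal.ne_zero i (Subtype.ext (by ext x; exact congrFun h0 x)),
    fun i j hij => ?_, fun i => ?_, fun i => ?_⟩
  · have : inner ℝ (b i : EuclideanSpace ℝ Y) (b j) = 0 := b.orthonormal.2 hij
    rwa [EuclideanSpace.inner_eq_star_dotProduct, star_trivial, dotProduct_comm] at this
  · have := (Submodule.mem_orthogonal_singleton_iff_inner_right (𝕜 := ℝ)).1 (b i).2
    rwa [EuclideanSpace.inner_eq_star_dotProduct, star_trivial] at this
  · have := congrArg (fun x : K => WithLp.ofLp (x : EuclideanSpace ℝ Y))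
      (hTK.apply_eigenvectorBasis rfl i)
    exact this

omit [DecidableEq Y] in
-- Compare both sides of the eigenvector equation at a coordinate of maximal modulus; the row sums
-- are `c`.
theorem eigenvalue_le_of_mulVec_one {B : Matrix Y Y ℝ} (hB : ∀ x y, 0 ≤ B x y) {c μ : ℝ}
    (h1 : B *ᵥ 1 = c • 1) {v : Y → ℝ} (hv : v ≠ 0) (hBv : B *ᵥ v = μ • v) : μ ≤ c := by
  obtain ⟨y₁, hy₁⟩ := Function.ne_iff.1 hv
  obtain ⟨y₀, -, hy₀⟩ := exists_max_image univ (fun y => |v y|) ⟨y₁, mem_univ _⟩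
  have hpos : 0 < |v y₀| := (abs_pos.2 hy₁).trans_le (hy₀ y₁ (mem_univ _))
  have h : |μ * v y₀| ≤ c * |v y₀| := by
    have e1 : μ * v y₀ = ∑ y, B y₀ y * v y := (congrFun hBv y₀).symm
    have e2 : c = ∑ y, B y₀ y := by
      have := congrFun h1 y₀
      simpa [mulVec, dotProduct] using this.symm
    rw [e1, e2, sum_mul]
    refine (abs_sum_le_sum_abs _ _).trans (sum_le_sum fun y _ => ?_)
    rw [abs_mul, abs_of_nonneg (hB _ _)]
    exact mul_le_mul_of_nonneg_left (hy₀ y (mem_univ _)) (hB _ _)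
  rw [abs_mul] at h
  exact (le_abs_self μ).trans (le_of_mul_le_mul_right h hpos)

omit [DecidableEq Y] in
theorem eigenvalue_transpose_mul_self_nonneg (M : Matrix X Y ℝ) {μ : ℝ} {v : Y → ℝ} (hv : v ≠ 0)
    (hMv : (Mᵀ * M) *ᵥ v = μ • v) : 0 ≤ μ := by
  have h := congrArg (fun u => v ⬝ᵥ u) hMv
  simp only [dotProduct_smul, smul_eq_mul] at h
  rw [← mulVec_mulVec, dotProduct_mulVec, vecMul_transpose] at h
  have hpos : 0 < v ⬝ᵥ v := lt_of_le_of_ne (sum_nonneg fun i _ => mul_self_nonneg (v i))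
    fun h0 => hv (dotProduct_self_eq_zero.1 h0.symm)
  by_contra hμ
  have h0 : 0 ≤ M *ᵥ v ⬝ᵥ M *ᵥ v := sum_nonneg fun i _ => mul_self_nonneg ((M *ᵥ v) i)
  rw [h] at h0
  exact absurd h0 (mul_neg_of_neg_of_pos (not_le.1 hμ) hpos).not_ge

omit [Fintype X] [DecidableEq Y] in
theorem prod_dotProduct_prod {k : ℕ} (v : ι → Y → ℝ) (j j' : Fin k → ι) :
    (fun y : Fin k → Y => ∏ i, v (j i) (y i)) ⬝ᵥ (fun y : Fin k → Y => ∏ i, v (j' i) (y i))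
      = ∏ i, v (j i) ⬝ᵥ v (j' i) := by
  classical
  simp only [dotProduct, ← prod_mul_distrib]
  rw [prod_univ_sum, Fintype.piFinset_univ]

/-- The sum, over the sets `S` of at least `t` coordinates, of the tensor products with factor `F`
at the coordinates in `S` and factor `J - F` at the others, `J` being the all-ones matrix. -/
def thresholdTensor (F : Matrix X Y ℝ) (k t : ℕ) : Matrix (Fin k → X) (Fin k → Y) ℝ :=
  Matrix.of fun x y => ∑ S : Finset (Fin k) with t ≤ #S,
    ∏ i, if i ∈ S then F (x i) (y i) else 1 - F (x i) (y i)

/-- The scalar by which `thresholdTensor F k t` acts on tensor products of vectors that `F` and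
`J - F` map to the multiples `p` and `q` of common vectors. -/
def thresholdCoeff (p q : ι → ℝ) {k : ℕ} (t : ℕ) (j : Fin k → ι) : ℝ :=
  ∑ S : Finset (Fin k) with t ≤ #S, ∏ i, if i ∈ S then p (j i) else q (j i)

omit [Fintype X] [Fintype Y] [DecidableEq Y] in
theorem transpose_thresholdTensor (F : Matrix X Y ℝ) (k t : ℕ) :
    (thresholdTensor F k t)ᵀ = thresholdTensor Fᵀ k t := rfl

omit [Fintype X] [DecidableEq Y] in
theorem thresholdTensor_mulVec_prod (F : Matrix X Y ℝ) (v : ι → Y → ℝ) (w : ι → X → ℝ)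
    (p q : ι → ℝ) (hp : ∀ j, F *ᵥ v j = p j • w j)
    (hq : ∀ j, (Matrix.of fun x y => 1 - F x y) *ᵥ v j = q j • w j) {k : ℕ} (t : ℕ)
    (j : Fin k → ι) :
    thresholdTensor F k t *ᵥ (fun y => ∏ i, v (j i) (y i))
      = thresholdCoeff p q t j • fun x => ∏ i, w (j i) (x i) := by
  classical
  ext x
  simp only [thresholdTensor, mulVec, dotProduct, of_apply, sum_mul, Pi.smul_apply, smul_eq_mul,
    thresholdCoeff, ← prod_mul_distrib]
  rw [sum_comm]
  refine sum_congr rfl fun S _ => ?_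
  rw [← Fintype.piFinset_univ, ← prod_univ_sum (fun _ => univ)
    (fun i y => (if i ∈ S then F (x i) y else 1 - F (x i) y) * v (j i) y)]
  refine prod_congr rfl fun i _ => ?_
  split_ifs with h
  · exact congrFun (hp (j i)) (x i)
  · exact congrFun (hq (j i)) (x i)

omit [Fintype X] [Fintype Y] [DecidableEq Y] in
-- For 0/1 entries only the summand where `S` is exactly the set of related coordinates survives.
theorem thresholdTensor_indicator (R : X → Y → Prop) [∀ x y, Decidable (R x y)] (k t : ℕ)
    (x : Fin k → X) (y : Fin k → Y) :
    thresholdTensor (Matrix.of fun x y => if R x y then (1 : ℝ) else 0) k t x y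
      = if t ≤ #{i | R (x i) (y i)} then 1 else 0 := by
  have h : ∀ S : Finset (Fin k), (∏ i, if i ∈ S then (if R (x i) (y i) then (1 : ℝ) else 0)
      else 1 - if R (x i) (y i) then (1 : ℝ) else 0)
      = if S = ({i | R (x i) (y i)} : Finset (Fin k)) then 1 else 0 := by
    intro S
    split_ifs with hS
    · refine prod_eq_one fun i _ => ?_
      by_cases hi : R (x i) (y i) <;> simp [hS, hi]
    · obtain ⟨i, hi⟩ : ∃ i, ¬ (i ∈ S ↔ R (x i) (y i)) := by
        by_contra! hc
        exact hS (by ext i; simpa using hc i)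
      refine prod_eq_zero (mem_univ i) ?_
      by_cases h1 : i ∈ S <;> by_cases h2 : R (x i) (y i) <;> simp_all
  simp only [thresholdTensor, of_apply, h]
  rw [sum_ite_eq']
  simp

end EigenvectorFamilies

/-! ### Estimates for the threshold coefficients -/

section ThresholdCoefficients

open Finset

theorem prod_ite_mem_const {k : ℕ} (S : Finset (Fin k)) (a b : ℝ) :
    (∏ i, if i ∈ S then a else b) = a ^ #S * b ^ (k - #S) := by
  rw [prod_ite, prod_const, prod_const, filter_mem_eq_inter, univ_inter, filter_notMem_eq_sdiff,
    ← compl_eq_univ_sdiff, card_compl, Fintype.card_fin]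

theorem thresholdCoeff_const {ι : Type*} (p q : ι → ℝ) (k t : ℕ) (o : ι) :
    thresholdCoeff p q t (fun _ : Fin k => o)
      = ∑ s ∈ Icc t k, (k.choose s : ℝ) * p o ^ s * q o ^ (k - s) := by
  simp only [thresholdCoeff, prod_ite_mem_const]
  rw [sum_filter, ← powerset_univ,
    sum_powerset_apply_card (fun s => if t ≤ s then p o ^ s * q o ^ (k - s) else 0), card_univ,
    Fintype.card_fin]
  simp only [smul_ite, smul_zero, nsmul_eq_mul, ← mul_assoc]
  rw [← sum_filter]
  refine sum_congr ?_ fun _ _ => rfl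
  ext s
  simp only [mem_filter, mem_range, mem_Icc]
  omega

/-- Pair each `S` avoiding `i₀` with `insert i₀ S`. Their products differ only in sign and cancel
when both sets reach size `t`; what remains are the pairs with `#S = t - 1`, where only the larger
set counts. -/
theorem thresholdCoeff_single {ι : Type*} (p q : ι → ℝ) (o a : ι) (hp : p a = 1) (hq : q a = -1)
    {k t : ℕ} (ht : 1 ≤ t) (i₀ : Fin k) :
    thresholdCoeff p q t (fun i => if i = i₀ then a else o)
      = ((k - 1).choose (t - 1) : ℝ) * p o ^ (t - 1) * q o ^ (k - t) := by
  have hins : (univ : Finset (Fin k)) = insert i₀ (univ.erase i₀) :=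
    (insert_erase (mem_univ i₀)).symm
  have hcard : #((univ : Finset (Fin k)).erase i₀) = k - 1 := by
    rw [card_erase_of_mem (mem_univ _), card_univ, Fintype.card_fin]
  have hprod : ∀ S ∈ ((univ : Finset (Fin k)).erase i₀).powerset,
      (∏ i ∈ univ.erase i₀, if i ∈ S then p o else q o) = p o ^ #S * q o ^ (k - 1 - #S) := by
    intro S hS
    rw [prod_ite, prod_const, prod_const, filter_mem_eq_inter, inter_eq_right.2 (mem_powerset.1 hS),
      filter_notMem_eq_sdiff, card_sdiff_of_subset (mem_powerset.1 hS), hcard]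
  have hrest : ∀ S T : Finset (Fin k), (∀ i, i ≠ i₀ → (i ∈ T ↔ i ∈ S)) →
      (∏ i ∈ univ.erase i₀, if i ∈ T then p (if i = i₀ then a else o)
        else q (if i = i₀ then a else o)) = ∏ i ∈ univ.erase i₀, if i ∈ S then p o else q o := by
    intro S T h
    refine prod_congr rfl fun i hi => ?_
    have hi := ne_of_mem_erase hi
    simp only [hi, if_false, h i hi]
  rw [thresholdCoeff, sum_filter, ← powerset_univ, hins, sum_powerset_insert (notMem_erase _ _),
    ← hins, ← sum_add_distrib]
  have hterm : ∀ S ∈ ((univ : Finset (Fin k)).erase i₀).powerset,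
      ((if t ≤ #S then ∏ i, (if i ∈ S then p (if i = i₀ then a else o)
          else q (if i = i₀ then a else o)) else 0) +
        if t ≤ #(insert i₀ S) then ∏ i, (if i ∈ insert i₀ S then p (if i = i₀ then a else o)
          else q (if i = i₀ then a else o)) else 0)
      = if #S = t - 1 then p o ^ (t - 1) * q o ^ (k - t) else 0 := by
    intro S hS
    have hi₀ : i₀ ∉ S := fun h => notMem_erase _ _ (mem_powerset.1 hS h)
    rw [card_insert_of_notMem hi₀, ← mul_prod_erase univ _ (mem_univ i₀),
      ← mul_prod_erase univ _ (mem_univ i₀), hrest S S (fun _ _ => Iff.rfl),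
      hrest S (insert i₀ S) (fun i hi => by simp [hi]), hprod S hS]
    simp only [hi₀, mem_insert_self, if_true, if_false, hp, hq]
    rcases lt_trichotomy #S (t - 1) with h | h | h
    · rw [if_neg (by omega), if_neg (by omega), if_neg (by omega), add_zero]
    · rw [if_neg (by omega), if_pos (by omega), if_pos h, h, show k - 1 - (t - 1) = k - t by omega]
      ring
    · rw [if_pos (by omega), if_pos (by omega), if_neg (by omega)]
      ring
  rw [sum_congr rfl hterm,
    sum_powerset_apply_card (fun s => if s = t - 1 then p o ^ (t - 1) * q o ^ (k - t) else 0), hcard]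
  simp only [smul_ite, smul_zero, nsmul_eq_mul]
  rw [sum_ite_eq']
  split_ifs with h
  · ring
  -- Here `t > k`, and the binomial coefficient vanishes too.
  · rw [mem_range] at h
    rw [Nat.choose_eq_zero_of_lt (by omega)]
    simp

theorem abs_thresholdCoeff_mul_prod_le {ι : Type*} {p q σ : ι → ℝ} {lam d e : ℝ} {o : ι}
    (hd : 0 < d) (hde : d ≤ e) (hlam : 0 ≤ lam) (hlamd : lam ≤ d) (hpo : p o = d) (hqo : q o = e)
    (hσo : σ o = 1) (hp : ∀ a, a ≠ o → p a = 1) (hq : ∀ a, a ≠ o → q a = -1)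
    (hσ : ∀ a, a ≠ o → σ a = lam) {k : ℕ} (t : ℕ) (j : Fin k → ι) (hj : j ≠ fun _ => o) :
    |thresholdCoeff p q t j| * ∏ i, σ (j i)
      ≤ lam / d * thresholdCoeff p q t (fun _ : Fin k => o) := by
  classical
  have hσ0 : ∀ a, 0 ≤ σ a := fun a => by
    by_cases h : a = o
    · rw [h, hσo]; exact zero_le_one
    · rw [hσ a h]; exact hlam
  obtain ⟨i₀, hi₀⟩ := Function.ne_iff.1 hj
  have he : 0 < e := hd.trans_le hde
  have hfac : ∀ (S : Finset (Fin k)) (i : Fin k), |if i ∈ S then p (j i) else q (j i)| * σ (j i)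
      ≤ if i ∈ S then d else e := by
    intro S i
    by_cases h : j i = o
    · rw [h, hpo, hqo, hσo, mul_one, abs_of_nonneg (by split_ifs <;> positivity)]
    · rw [hp _ h, hq _ h, hσ _ h]
      split_ifs
      · simpa using hlamd
      · simpa using hlamd.trans hde
  -- The gain comes from the one coordinate `i₀`: `lam = (lam / d) * d ≤ (lam / d) * e`. The other
  -- coordinates are bounded by `hfac`.
  have hfac₀ : ∀ S : Finset (Fin k), |if i₀ ∈ S then p (j i₀) else q (j i₀)| * σ (j i₀)
      ≤ lam / d * if i₀ ∈ S then d else e := by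
    intro S
    rw [hp _ hi₀, hq _ hi₀, hσ _ hi₀]
    split_ifs
    · rw [div_mul_cancel₀ _ hd.ne', abs_one, one_mul]
    · rw [abs_neg, abs_one, one_mul, div_mul_eq_mul_div, le_div_iff₀ hd]
      exact mul_le_mul_of_nonneg_left hde hlam
  simp only [thresholdCoeff, hpo, hqo]
  rw [mul_sum]
  refine (mul_le_mul_of_nonneg_right (abs_sum_le_sum_abs _ _)
    (prod_nonneg fun i _ => hσ0 (j i))).trans ?_
  rw [sum_mul]
  refine sum_le_sum fun S _ => ?_
  rw [abs_prod, ← prod_mul_distrib, ← mul_prod_erase univ _ (mem_univ i₀),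
    ← mul_prod_erase univ (fun i => if i ∈ S then d else e) (mem_univ i₀), ← mul_assoc]
  refine mul_le_mul (hfac₀ S) (prod_le_prod (fun i _ => mul_nonneg (abs_nonneg _) (hσ0 _))
    fun i _ => hfac S i) (prod_nonneg fun i _ => mul_nonneg (abs_nonneg _) (hσ0 _)) ?_
  have : (0 : ℝ) ≤ if i₀ ∈ S then d else e := by split_ifs <;> positivity
  positivity

theorem alphaCoeff_pos (k t : ℕ) : 0 < alphaCoeff k t := by
  refine sum_pos (fun l hl => ?_) ⟨0, by simp⟩
  have h1 : 0 < (k - t).choose l := Nat.choose_pos (by simpa [Nat.lt_succ_iff] using hl)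
  have h2 : 0 < (t + l).choose l := Nat.choose_pos (Nat.le_add_left _ _)
  positivity

/-- With `s = t + l`, the ratio of binomials `C(k,t+l) / C(k,t)` equals `C(k-t,l) / C(t+l,l)`, and
trading `l` factors `d` for `e` only increases the product. -/
theorem sum_choose_mul_pow_le_alphaCoeff {k t : ℕ} (htk : t ≤ k) {d e : ℝ} (hd : 0 ≤ d)
    (hde : d ≤ e) : ∑ s ∈ Icc t k, (k.choose s : ℝ) * d ^ s * e ^ (k - s)
      ≤ alphaCoeff k t * ((k.choose t : ℝ) * d ^ t * e ^ (k - t)) := by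
  have hIcc : Icc t k = Ico t (k + 1) := by ext s; simp only [mem_Icc, mem_Ico]; omega
  rw [hIcc, sum_Ico_eq_sum_range, show k + 1 - t = k - t + 1 by omega, alphaCoeff, sum_mul]
  refine sum_le_sum fun l hl => ?_
  have hl : l ≤ k - t := by simpa [Nat.lt_succ_iff] using hl
  have hpos : (0 : ℝ) < (t + l).choose l := by
    exact_mod_cast Nat.choose_pos (Nat.le_add_left _ _)
  have hch : (k.choose (t + l) : ℝ) * (t + l).choose l = k.choose t * (k - t).choose l := by
    have := Nat.choose_mul (n := k) (k := t + l) (s := t) (Nat.le_add_right _ _)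
    rw [Nat.add_sub_cancel_left, Nat.choose_symm_add] at this
    exact_mod_cast this
  have hch' : (k.choose (t + l) : ℝ) = k.choose t * (k - t).choose l / (t + l).choose l := by
    rw [eq_div_iff hpos.ne', hch]
  have hpow : d ^ (t + l) * e ^ (k - (t + l)) ≤ d ^ t * e ^ (k - t) := by
    rw [show k - t = l + (k - (t + l)) by omega, pow_add, pow_add, mul_assoc]
    have he : 0 ≤ e := hd.trans hde
    gcongr
  calc (k.choose (t + l) : ℝ) * d ^ (t + l) * e ^ (k - (t + l))
      = k.choose (t + l) * (d ^ (t + l) * e ^ (k - (t + l))) := by ring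
    _ ≤ k.choose (t + l) * (d ^ t * e ^ (k - t)) := by gcongr
    _ = _ := by rw [hch']; ring

theorem lower_bound_le_choose_mul_pow {k t : ℕ} (ht : 1 ≤ t) (htk : t ≤ k) {lam d e : ℝ}
    (hlam : 0 ≤ lam) (hd : 0 < d) (hde : d ≤ e) :
    lam / d * (1 / alphaCoeff k t) * ((t : ℝ) / (k : ℝ))
        * ∑ s ∈ Icc t k, (k.choose s : ℝ) * d ^ s * e ^ (k - s)
      ≤ lam * (((k - 1).choose (t - 1) : ℝ) * d ^ (t - 1) * e ^ (k - t)) := by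
  have hα := alphaCoeff_pos k t
  obtain ⟨k, rfl⟩ : ∃ k', k = k' + 1 := ⟨k - 1, by omega⟩
  obtain ⟨t, rfl⟩ : ∃ t', t = t' + 1 := ⟨t - 1, by omega⟩
  have hch : ((k + 1 : ℕ) : ℝ) * k.choose t = (k + 1).choose (t + 1) * ((t + 1 : ℕ) : ℝ) := by
    exact_mod_cast Nat.add_one_mul_choose_eq k t
  have hk : (0 : ℝ) < ((k + 1 : ℕ) : ℝ) := by positivity
  calc _ ≤ lam / d * (1 / alphaCoeff (k + 1) (t + 1)) * (((t + 1 : ℕ) : ℝ) / ((k + 1 : ℕ) : ℝ))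
        * (alphaCoeff (k + 1) (t + 1)
          * (((k + 1).choose (t + 1) : ℝ) * d ^ (t + 1) * e ^ (k + 1 - (t + 1)))) := by
        have := sum_choose_mul_pow_le_alphaCoeff htk hd.le hde
        gcongr
    _ = lam * ((((k + 1).choose (t + 1) * ((t + 1 : ℕ) : ℝ)) / ((k + 1 : ℕ) : ℝ)) * d ^ t
          * e ^ (k + 1 - (t + 1))) := by
        rw [pow_succ]; field_simp
    _ = _ := by
        rw [← hch, mul_div_cancel_left₀ _ hk.ne']; simp

end ThresholdCoefficients

/-! ### Spectral bounds for matrices with constant line sums -/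

section BiregularBiadjacency

open Finset Matrix

/-- The vectors `w` need no normalisation: `s` records the extra scalar met on the way back through
the transpose, so it enters once while `p` and `q` enter twice. -/
theorem thresholdTensor_gram_mulVec_prod {X Y ι : Type*} [Fintype X] [Fintype Y]
    (F : Matrix X Y ℝ) (v : ι → Y → ℝ) (w : ι → X → ℝ) (p q s : ι → ℝ)
    (hp : ∀ j, F *ᵥ v j = p j • w j)
    (hq : ∀ j, (Matrix.of fun x y => 1 - F x y) *ᵥ v j = q j • w j)
    (hp' : ∀ j, Fᵀ *ᵥ w j = p j • s j • v j)
    (hq' : ∀ j, (Matrix.of fun y x => 1 - Fᵀ y x) *ᵥ w j = q j • s j • v j) {k : ℕ} (t : ℕ)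
    (j : Fin k → ι) :
    ((thresholdTensor F k t)ᵀ * thresholdTensor F k t) *ᵥ (fun y => ∏ i, v (j i) (y i))
      = (thresholdCoeff p q t j ^ 2 * ∏ i, s (j i)) • fun y => ∏ i, v (j i) (y i) := by
  rw [← mulVec_mulVec, thresholdTensor_mulVec_prod F v w p q hp hq t j, mulVec_smul,
    transpose_thresholdTensor,
    thresholdTensor_mulVec_prod Fᵀ w (fun j => s j • v j) p q hp' hq' t j, smul_smul]
  ext y
  simp only [Pi.smul_apply, smul_eq_mul, prod_mul_distrib]
  ring

theorem one_sub_mulVec {X Y : Type*} [Fintype Y] (F : Matrix X Y ℝ) (u : Y → ℝ) :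
    (Matrix.of fun x y => 1 - F x y) *ᵥ u = (u ⬝ᵥ 1) • 1 - F *ᵥ u := by
  ext x
  simp [mulVec, dotProduct, sub_mul]

/-- For a nonnegative square matrix `M` of order at least `2 * d` with all line sums `d`, the third
largest absolute eigenvalue of a bipartite graph with biadjacency matrix `thresholdTensor M k t` is
controlled by the one of a bipartite graph with biadjacency matrix `M`. -/
theorem thirdAbsEigenvalue_thresholdTensor_bounds {X Y W W' : Type*} [Fintype X] [DecidableEq X]
    [Fintype Y] [DecidableEq Y] [Fintype W] [DecidableEq W] [Fintype W'] [DecidableEq W']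
    (M : Matrix X Y ℝ) (hM : ∀ x y, 0 ≤ M x y) {d : ℝ} (hd : 0 < d)
    (hrow : M *ᵥ 1 = d • 1) (hcol : Mᵀ *ᵥ 1 = d • 1) (hXY : Fintype.card X = Fintype.card Y)
    (hY : 2 ≤ Fintype.card Y) (hdY : 2 * d ≤ Fintype.card Y) {k t : ℕ} (hk : 1 ≤ k) (htk : t ≤ k)
    (H : SimpleGraph W) [DecidableRel H.Adj] (e : W ≃ X ⊕ Y)
    (hH : Matrix.reindex e e (H.adjMatrix ℝ) = fromBlocks 0 M Mᵀ 0)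
    (H' : SimpleGraph W') [DecidableRel H'.Adj] (e' : W' ≃ (Fin k → X) ⊕ (Fin k → Y))
    (hH' : Matrix.reindex e' e' (H'.adjMatrix ℝ)
      = fromBlocks 0 (thresholdTensor M k t) (thresholdTensor M k t)ᵀ 0) :
    thirdAbsEigenvalue H / d * (1 / alphaCoeff k t) * ((t : ℝ) / (k : ℝ))
        * ∑ s ∈ Icc t k, (k.choose s : ℝ) * d ^ s * (Fintype.card Y - d) ^ (k - s)
      ≤ thirdAbsEigenvalue H' ∧
    thirdAbsEigenvalue H' ≤ thirdAbsEigenvalue H / d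
        * ∑ s ∈ Icc t k, (k.choose s : ℝ) * d ^ s * (Fintype.card Y - d) ^ (k - s) := by
  have hYne : Nonempty Y := Fintype.card_pos_iff.1 (by omega)
  have hgram1 : (Mᵀ * M) *ᵥ 1 = (d ^ 2) • (1 : Y → ℝ) := by
    rw [← mulVec_mulVec, hrow, mulVec_smul, hcol, smul_smul, sq]
  have hherm : (Mᵀ * M).IsHermitian := by
    have := isHermitian_conjTranspose_mul_self M
    rwa [conjTranspose_eq_transpose_of_trivial] at this
  have hgram0 : ∀ x y, 0 ≤ (Mᵀ * M) x y := fun x y => by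
    rw [mul_apply]
    exact sum_nonneg fun z _ => mul_nonneg (hM z x) (hM z y)
  obtain ⟨r, v, μ, hr, hv0, hvo, hv1, hvB⟩ := exists_orthogonal_eigenvectors_of_mulVec_one hherm
    hgram1
  have hμ0 : ∀ a, 0 ≤ μ a := fun a => eigenvalue_transpose_mul_self_nonneg M (hv0 a) (hvB a)
  have hμd : ∀ a, μ a ≤ d ^ 2 := fun a => eigenvalue_le_of_mulVec_one hgram0 hgram1 (hv0 a) (hvB a)
  have : Nonempty (Fin r) := ⟨⟨0, by omega⟩⟩
  obtain ⟨a, -, ha⟩ := exists_max_image univ μ ⟨Classical.arbitrary _, mem_univ _⟩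
  set lam := Real.sqrt (μ a) with hlam
  have hlam0 : 0 ≤ lam := Real.sqrt_nonneg _
  have hlamsq : lam ^ 2 = μ a := Real.sq_sqrt (hμ0 a)
  have hlamd : lam ≤ d := by
    rw [← sq_le_sq₀ hlam0 hd.le, hlamsq]; exact hμd a
  have hX1 : (1 : Y → ℝ) ⬝ᵥ 1 = Fintype.card Y := by simp
  have hX1' : (1 : X → ℝ) ⬝ᵥ 1 = Fintype.card Y := by simp [hXY]
  set E : ℝ := Fintype.card Y - d with hE
  have hdE : d ≤ E := by linarith
  -- The index `none` stands for the all-ones vector, `some i` for `v i`. Taking `M *ᵥ v i` itself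
  -- as partner makes `p = 1`, `q = -1`, and moves the eigenvalue into `s`; it also allows `M *ᵥ v i
  -- = 0`.
  set ev : Option (Fin r) → Y → ℝ := fun o => o.elim 1 v with hev
  set wv : Option (Fin r) → X → ℝ := fun o => o.elim 1 fun i => M *ᵥ v i with hwv
  set p : Option (Fin r) → ℝ := fun o => o.elim d fun _ => 1 with hp
  set q : Option (Fin r) → ℝ := fun o => o.elim E fun _ => -1 with hq
  set s : Option (Fin r) → ℝ := fun o => o.elim 1 μ with hs
  set σ : Option (Fin r) → ℝ := fun o => o.elim 1 fun _ => lam with hσ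
  have hcard : Fintype.card (Option (Fin r)) = Fintype.card Y := by simp [hr]
  have hev0 : ∀ o, ev o ≠ 0 := by
    rintro (_ | i)
    · exact one_ne_zero
    · exact hv0 i
  have hevo : ∀ o o', o ≠ o' → ev o ⬝ᵥ ev o' = 0 := by
    rintro (_ | i) (_ | j) hij
    · exact absurd rfl hij
    · exact (dotProduct_comm _ _).trans (hv1 j)
    · exact hv1 i
    · exact hvo i j fun h => hij (h ▸ rfl)
  have hMp : ∀ o, M *ᵥ ev o = p o • wv o := by
    rintro (_ | i)
    · exact hrow
    · exact (one_smul ℝ _).symm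
  have hMp' : ∀ o, Mᵀ *ᵥ wv o = p o • s o • ev o := by
    rintro (_ | i)
    · exact hcol.trans (by simp [hp, hs, hev])
    · change Mᵀ *ᵥ (M *ᵥ v i) = (1 : ℝ) • μ i • v i
      rw [mulVec_mulVec, hvB, one_smul]
  have hMq : ∀ o, (Matrix.of fun x y => 1 - M x y) *ᵥ ev o = q o • wv o := by
    rintro (_ | i)
    · change _ *ᵥ 1 = E • 1
      rw [one_sub_mulVec, hX1, hrow, ← sub_smul]
    · change _ *ᵥ v i = (-1 : ℝ) • M *ᵥ v i
      rw [one_sub_mulVec, hv1, zero_smul, zero_sub, neg_one_smul]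
  have hMq' : ∀ o, (Matrix.of fun y x => 1 - Mᵀ y x) *ᵥ wv o = q o • s o • ev o := by
    rintro (_ | i)
    · change _ *ᵥ 1 = E • (1 : ℝ) • 1
      rw [one_sub_mulVec, hX1', hcol, ← sub_smul, one_smul]
    · change _ *ᵥ (M *ᵥ v i) = (-1 : ℝ) • μ i • v i
      rw [one_sub_mulVec, dotProduct_comm, dotProduct_mulVec, ← mulVec_transpose, hcol,
        smul_dotProduct, dotProduct_comm, hv1, smul_zero, zero_smul, zero_sub, mulVec_mulVec, hvB,
        neg_one_smul]
  have hevB : ∀ o, (Mᵀ * M) *ᵥ ev o = (o.elim (d ^ 2) μ) • ev o := by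
    rintro (_ | i)
    · exact hgram1
    · exact hvB i
  have hthird : thirdAbsEigenvalue H = lam := by
    refine le_antisymm
      (thirdAbsEigenvalue_le_of_biadjacency H e M hH hXY ev _ hcard hev0 hevo hevB hlam0 none ?_)
      (le_thirdAbsEigenvalue_of_biadjacency H e M hH hXY ev _ hcard hev0 hevo hevB hlam0
        (j₀ := none) (j₁ := some a) (by simp) ?_ ?_)
    · rintro (_ | i) hi
      · exact absurd rfl hi
      · rw [hlamsq]; exact ha i (mem_univ _)
    · rw [hlamsq]; exact hμd a
    · exact hlamsq.le
  set D := ∑ s ∈ Icc t k, (k.choose s : ℝ) * d ^ s * E ^ (k - s) with hD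
  have hcD : thresholdCoeff p q t (fun _ : Fin k => none) = D := thresholdCoeff_const p q k t none
  have hE0 : 0 ≤ E := hd.le.trans hdE
  have hD0 : 0 ≤ D := sum_nonneg fun _ _ => by positivity
  have hcardk : Fintype.card (Fin k → Option (Fin r)) = Fintype.card (Fin k → Y) := by
    rw [Fintype.card_fun, Fintype.card_fun, hcard]
  have hXYk : Fintype.card (Fin k → X) = Fintype.card (Fin k → Y) := by
    rw [Fintype.card_fun, Fintype.card_fun, hXY]
  have hV0 : ∀ j : Fin k → Option (Fin r), (fun y : Fin k → Y => ∏ i, ev (j i) (y i)) ≠ 0 := by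
    intro j h0
    rw [← dotProduct_self_eq_zero, prod_dotProduct_prod] at h0
    obtain ⟨i, -, hi⟩ := prod_eq_zero_iff.1 h0
    exact hev0 _ (dotProduct_self_eq_zero.1 hi)
  have hVo : ∀ j j' : Fin k → Option (Fin r), j ≠ j' →
      (fun y : Fin k → Y => ∏ i, ev (j i) (y i)) ⬝ᵥ (fun y => ∏ i, ev (j' i) (y i)) = 0 := by
    intro j j' hj
    obtain ⟨i, hi⟩ := Function.ne_iff.1 hj
    rw [prod_dotProduct_prod]
    exact prod_eq_zero (mem_univ i) (hevo _ _ hi)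
  have hVB := thresholdTensor_gram_mulVec_prod M ev wv p q s hMp hMq hMp' hMq' (k := k) t
  have hs0 : ∀ o, 0 ≤ s o := by
    rintro (_ | i)
    · exact zero_le_one
    · exact hμ0 i
  have hsσ : ∀ o, s o ≤ σ o ^ 2 := by
    rintro (_ | i)
    · exact (one_pow 2).ge
    · exact (ha i (mem_univ _)).trans hlamsq.ge
  have hupper : ∀ j : Fin k → Option (Fin r), (j ≠ fun _ => none) →
      |thresholdCoeff p q t j| * ∏ i, σ (j i) ≤ lam / d * D := by
    intro j hj
    rw [← hcD]
    refine abs_thresholdCoeff_mul_prod_le (p := p) (q := q) (σ := σ) (o := none)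
      hd hdE hlam0 hlamd rfl rfl rfl ?_ ?_ ?_ t j hj
    all_goals
      rintro (_ | i) hi
      · exact absurd rfl hi
      · rfl
  rw [hthird]
  refine ⟨?_, ?_⟩
  · set i₀ : Fin k := ⟨0, hk⟩
    set j₁ : Fin k → Option (Fin r) := fun i => if i = i₀ then some a else none with hj₁
    have hj : (fun _ => none) ≠ j₁ := fun h => by
      have := congrFun h i₀
      simp [hj₁] at this
    have hsel : ∀ f : Option (Fin r) → ℝ, f none = 1 → ∏ i, f (j₁ i) = f (some a) := by
      intro f hf
      rw [prod_eq_single i₀ (fun i _ hi => by simp [hj₁, hi, hf]) (by simp)]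
      simp [hj₁]
    have hb0 : 0 ≤ |thresholdCoeff p q t j₁| * lam := by positivity
    -- Two Gram eigenvalues must reach the bound; this supplies the one of the all-ones tensor, the
    -- other being that of `j₁`.
    have hbD : |thresholdCoeff p q t j₁| * lam ≤ D := by
      have h1 := hupper j₁ hj.symm
      rw [hsel σ rfl] at h1
      exact h1.trans (mul_le_of_le_one_left hD0 ((div_le_one hd).2 hlamd))
    refine le_trans ?_ (le_thirdAbsEigenvalue_of_biadjacency H' e' _ hH' hXYk _ _ hcardk hV0 hVo hVB
      hb0 hj ?_ ?_)
    -- For `t = 0` the factor `t / k` makes the lower bound zero.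
    · rcases Nat.eq_zero_or_pos t with rfl | ht
      · simpa using hb0
      · rw [thresholdCoeff_single p q none (some a) rfl rfl ht]
        refine (lower_bound_le_choose_mul_pow ht htk hlam0 hd hdE).trans ?_
        rw [mul_comm]
        exact mul_le_mul_of_nonneg_right (le_abs_self _) hlam0
    · rw [hcD]
      simp only [hs, Option.elim_none, prod_const_one, mul_one]
      exact pow_le_pow_left₀ hb0 hbD 2
    · rw [hsel s rfl, mul_pow, sq_abs, hlamsq]
      exact le_rfl
  · refine thirdAbsEigenvalue_le_of_biadjacency H' e' _ hH' hXYk _ _ hcardk hV0 hVo hVB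
      (by positivity) (fun _ => none) fun j hj => ?_
    refine le_trans ?_ (pow_le_pow_left₀ ?_ (hupper j hj) 2)
    · rw [mul_pow, sq_abs, ← prod_pow]
      exact mul_le_mul_of_nonneg_left (prod_le_prod (fun i _ => hs0 _) fun i _ => hsσ _)
        (sq_nonneg _)
    · refine mul_nonneg (abs_nonneg _) (prod_nonneg fun i _ => ?_)
      rcases j i with _ | _
      · exact zero_le_one
      · exact hlam0

end BiregularBiadjacency

/-! ### Regular bipartite graphs and their products -/

section RegularBipartite

open Finset Matrix

variable {V : Type*} [Fintype V] [DecidableEq V] (G : SimpleGraph V) [DecidableRel G.Adj]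

/-- The biadjacency matrix of a graph with respect to two finite vertex sets. -/
def biadjMatrix (X Y : Finset V) : Matrix X Y ℝ :=
  Matrix.of fun x y => if G.Adj x y then 1 else 0

omit [Fintype V] [DecidableEq V] in
theorem transpose_biadjMatrix (X Y : Finset V) :
    (biadjMatrix G X Y)ᵀ = biadjMatrix G Y X := by
  ext y x
  simp [biadjMatrix, G.adj_comm]

variable {G} {X Y : Finset V}

omit [DecidableEq V] in
theorem biadjMatrix_mulVec_one (hG : G.IsBipartiteWith (X : Set V) (Y : Set V)) {d : ℕ}
    (hreg : G.IsRegularOfDegree d) : biadjMatrix G X Y *ᵥ 1 = (d : ℝ) • 1 := by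
  ext x
  have h : #(Y.filter fun y => G.Adj x y) = d := by
    rw [← hreg x, ← G.card_neighborFinset_eq_degree,
      SimpleGraph.isBipartiteWith_neighborFinset hG x.2]
  simp only [mulVec, dotProduct, biadjMatrix, of_apply, Pi.one_apply, mul_one, Pi.smul_apply,
    smul_eq_mul]
  rw [Finset.univ_eq_attach, Finset.sum_attach Y fun y => if G.Adj x y then (1 : ℝ) else 0,
    sum_boole, h]

/-- The vertices of a bipartite graph as the disjoint union of its two classes. -/
noncomputable def bipartiteEquivSum (hG : G.IsBipartiteWith (X : Set V) (Y : Set V))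
    (hXY : X ∪ Y = univ) : V ≃ X ⊕ Y :=
  (Equiv.ofBijective (Sum.elim Subtype.val Subtype.val) (by
    have hdisj := Finset.disjoint_left.1 (Finset.disjoint_coe.1 hG.disjoint)
    refine ⟨?_, fun v => ?_⟩
    · rintro (x | y) (x' | y') h
      · exact congrArg Sum.inl (Subtype.ext h)
      · exact absurd y'.2 ((show (x : V) = y' from h) ▸ hdisj x.2)
      · exact absurd y.2 ((show (y : V) = x' from h) ▸ hdisj x'.2)
      · exact congrArg Sum.inr (Subtype.ext h)
    · rcases Finset.mem_union.1 (hXY ▸ mem_univ v) with hv | hv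
      · exact ⟨Sum.inl ⟨v, hv⟩, rfl⟩
      · exact ⟨Sum.inr ⟨v, hv⟩, rfl⟩)).symm

omit [DecidableRel G.Adj] in
theorem bipartiteEquivSum_symm_inl (hG : G.IsBipartiteWith (X : Set V) (Y : Set V))
    (hXY : X ∪ Y = univ) (x : X) : (bipartiteEquivSum hG hXY).symm (Sum.inl x) = x := rfl

omit [DecidableRel G.Adj] in
theorem bipartiteEquivSum_symm_inr (hG : G.IsBipartiteWith (X : Set V) (Y : Set V))
    (hXY : X ∪ Y = univ) (y : Y) : (bipartiteEquivSum hG hXY).symm (Sum.inr y) = y := rfl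

theorem reindex_adjMatrix_of_isBipartiteWith (hG : G.IsBipartiteWith (X : Set V) (Y : Set V))
    (hXY : X ∪ Y = univ) :
    Matrix.reindex (bipartiteEquivSum hG hXY) (bipartiteEquivSum hG hXY) (G.adjMatrix ℝ)
      = fromBlocks 0 (biadjMatrix G X Y) (biadjMatrix G X Y)ᵀ 0 := by
  have hdisj := Finset.disjoint_left.1 (Finset.disjoint_coe.1 hG.disjoint)
  ext (x | y) (x' | y')
  · have : ¬ G.Adj x x' := fun h => hdisj x'.2 (hG.mem_of_mem_adj x.2 h)
    simp [bipartiteEquivSum_symm_inl, this]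
  · simp [bipartiteEquivSum_symm_inl, bipartiteEquivSum_symm_inr, biadjMatrix]
  · simp [bipartiteEquivSum_symm_inl, bipartiteEquivSum_symm_inr, biadjMatrix, G.adj_comm]
  · have : ¬ G.Adj y y' := fun h => hdisj (hG.symm.mem_of_mem_adj y.2 h) y'.2
    simp [bipartiteEquivSum_symm_inr, this]

omit [Fintype V] [DecidableEq V] in
theorem adjMatrix_bipGraphProduct (k t : ℕ) :
    (bipGraphProduct G X Y k t).adjMatrix ℝ
      = fromBlocks 0 (thresholdTensor (biadjMatrix G X Y) k t)
        (thresholdTensor (biadjMatrix G X Y) k t)ᵀ 0 := by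
  have h := thresholdTensor_indicator (fun (x : X) (y : Y) => G.Adj x y) k t
  ext (x | y) (x' | y')
  · rw [SimpleGraph.adjMatrix_apply]
    exact if_neg id
  · simp only [SimpleGraph.adjMatrix_apply, fromBlocks_apply₁₂, biadjMatrix, h]
    rfl
  · simp only [SimpleGraph.adjMatrix_apply, fromBlocks_apply₂₁, transpose_apply, biadjMatrix, h]
    rfl
  · rw [SimpleGraph.adjMatrix_apply]
    exact if_neg id

omit [DecidableEq V] in
theorem card_eq_card_of_isRegularOfDegree (hG : G.IsBipartiteWith (X : Set V) (Y : Set V))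
    {d : ℕ} (hd : 1 ≤ d) (hreg : G.IsRegularOfDegree d) : #X = #Y := by
  have h := SimpleGraph.isBipartiteWith_sum_degrees_eq hG
  simp only [hreg _, sum_const, smul_eq_mul] at h
  exact Nat.eq_of_mul_eq_mul_right hd h

end RegularBipartite

theorem mainTheorem2 {V : Type*} [Fintype V] [DecidableEq V]
    (G : SimpleGraph V) [DecidableRel G.Adj] (X Y : Finset V)
    (hG : G.IsBipartiteWith (X : Set V) (Y : Set V)) (hXY : X ∪ Y = Finset.univ)
    (d : ℕ) (hd : 1 ≤ d) (hreg : G.IsRegularOfDegree d)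
    (hdn : (d : ℝ) ≤ (Fintype.card V : ℝ) / 4)
    (k t : ℕ) (hk : 1 ≤ k) (htk : t ≤ k) :
    thirdAbsEigenvalue G / (d : ℝ) * (1 / alphaCoeff k t) * ((t : ℝ) / (k : ℝ))
          * bipProductDegree (Fintype.card V) d k t
        ≤ thirdAbsEigenvalue (bipGraphProduct G X Y k t) ∧
      thirdAbsEigenvalue (bipGraphProduct G X Y k t)
        ≤ thirdAbsEigenvalue G / (d : ℝ) * bipProductDegree (Fintype.card V) d k t := by
  have hcard := card_eq_card_of_isRegularOfDegree hG hd hreg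
  have hV : Fintype.card V = 2 * Y.card := by
    rw [← Finset.card_univ, ← hXY, Finset.card_union_of_disjoint (Finset.disjoint_coe.1 hG.disjoint),
      hcard, two_mul]
  -- Equivalent to `d ≤ n/2 - d`, the form in which `d ≤ n/4` enters the estimates.
  have hdY : 2 * d ≤ Y.card := by
    rw [hV] at hdn
    push_cast at hdn
    have : (2 * d : ℝ) ≤ Y.card := by linarith
    exact_mod_cast this
  have hhalf : (Fintype.card V : ℝ) / 2 = Fintype.card Y := by
    rw [hV, Fintype.card_coe]; push_cast; ring
  rw [bipProductDegree, hhalf]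
  refine thirdAbsEigenvalue_thresholdTensor_bounds (biadjMatrix G X Y)
    (fun x y => ?_) (by exact_mod_cast hd) (biadjMatrix_mulVec_one hG hreg) ?_
    (by simpa using hcard) (by rw [Fintype.card_coe]; omega)
    (by rw [Fintype.card_coe]; exact_mod_cast hdY) hk htk G (bipartiteEquivSum hG hXY)
    (reindex_adjMatrix_of_isBipartiteWith hG hXY) _ (Equiv.refl _) ?_
  · simp only [biadjMatrix, Matrix.of_apply]
    split_ifs <;> norm_num
  · rw [transpose_biadjMatrix]
    exact biadjMatrix_mulVec_one hG.symm hreg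
  · rw [← adjMatrix_bipGraphProduct]
    rfl
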